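/- Fix $n\in\mathbb N$ and let $X=S_0\sqcup S_1\sqcup S_2\sqcup\cdots$ be a disjoint union of unit $n$-cubes $S_i=[0,1]^n$. A \emph{pattern} in $X$ is a subdivision of $X$ into axis-parallel rectangles obtained from the undivided $X$ by finitely many cuts, each of which cuts one rectangle of the current subdivision in half across one of the $n$ dimensions. A \emph{numbered pattern} is a pattern together with a bijection from $\{0,1,2,\dots\}$ to its rectangles such that, for some $N,k\ge 0$, the cube $S_j$ is undivided and has number $j+k$ for all $j\ge N$. Let $\Pi_n$ be the monoid of numbered patterns, where the product $PQ$ is obtained by applying, for every $i$, the pattern of $Q$ in $S_i$ to the rectangle numbered $i$ of $P$ (through the coordinatewise increasing affine map of $S_i$ onto that rectangle), each new rectangle taking its number from $Q$; the identity is the undivided $X$ with $S_i$ numbered $i$. For $i\ge 0$ and $1\le d\le n$ let $s_{i,d}\in\Pi_n$ be the numbered pattern that cuts $S_i$ in half across dimension $d$, the lower half (smaller $d$-th coordinate) having number $i$, the upper half having number $i+1$, $S_j$ having number $j$ for $j<i$ and number $j+1$ for $j>i$. Let $\sigma_i\in\Pi_n$ be the undivided $X$ in which $S_i$ has number $i+1$,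 $S_{i+1}$ has number $i$, and every other $S_j$ has number $j$. \textbf{Theorem.} The monoid $\Pi_n$ is presented by the generators $s_{i,d}$ ($i\ge0$, $1\le d\le n$) and $\sigma_i$ ($i\ge 0$) and the following relations, where all indices $i,j$ are $\ge0$ and $1\le d,d'\le n$: \[ \begin{array}{lll} (M1) & s_{j,d'}s_{i,d}=s_{i,d}s_{j+1,d'} & i<j,\\ (M2) & \sigma_i^2=1 & i\ge 0,\\ (M3) & \sigma_i\sigma_j=\sigma_j\sigma_i & |i-j|\ge 2,\\ (M4) & \sigma_i\sigma_{i+1}\sigma_i=\sigma_{i+1}\sigma_i\sigma_{i+1} & i\ge 0,\\ (M5a) & \sigma_j s_{i,d}=s_{i,d}\sigma_{j+1} & i<j,\\ (M5b) & \sigma_j s_{i,d}=s_{j+1,d}\sigma_j\sigma_{j+1} & i=j,\\ (M5c) & \sigma_j s_{i,d}=s_{j,d}\sigma_{j+1}\sigma_j & i=j+1,\\ (M5d) & \sigma_j s_{i,d}=s_{i,d}\sigma_j & i>j+1,\\ (M6) & s_{i,d}s_{i+1,d'}s_{i,d'}=s_{i,d'}s_{i+1,d}s_{i,d}\sigma_{i+1}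 & i\ge 0,\ d\ne d'. \end{array} \] That is, the assignment of these numbered patterns to the abstract generators extends to an isomorphism from the monoid with this presentation onto $\Pi_n$. -/

import Mathlib

noncomputable section

namespace CubePattern

/-- An axis-parallel `n`-dimensional rectangle in `X = S₀ ⊔ S₁ ⊔ ⋯`, the disjoint union of countably
many copies of the unit cube `[0,1]ⁿ`: it lies in the cube `S_cube` and is the product over the
dimensions `d` of the intervals `[corner d, corner d + side d]`. -/
@[ext]
structure Rect (n : ℕ) where
  cube : ℕ
  corner : Fin n → ℝ
  side : Fin n → ℝ

variable {n : ℕ}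

namespace Rect

/-- The whole unit cube `Sᵢ`. -/
def unit (i : ℕ) : Rect n := ⟨i, fun _ => 0, fun _ => 1⟩

/-- The first half of `R` when it is cut in half across dimension `d`. -/
def lowerHalf (R : Rect n) (d : Fin n) : Rect n :=
  ⟨R.cube, R.corner, Function.update R.side d (R.side d / 2)⟩

/-- The second half of `R` when it is cut in half across dimension `d`. -/
def upperHalf (R : Rect n) (d : Fin n) : Rect n :=
  ⟨R.cube, Function.update R.corner d (R.corner d + R.side d / 2),
    Function.update R.side d (R.side d / 2)⟩

/-- The image of a rectangle `T` of a unit cube under the coordinatewise increasing affine map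
`x ↦ corner + side * x` of that unit cube onto `R`. -/
def place (R T : Rect n) : Rect n :=
  ⟨R.cube, fun d => R.corner d + R.side d * T.corner d, fun d => R.side d * T.side d⟩

@[simp] theorem unit_cube (i : ℕ) : (unit i : Rect n).cube = i := rfl

@[simp] theorem place_unit (R : Rect n) (i : ℕ) : R.place (unit i) = R := by
  ext <;> simp [place, unit]

@[simp] theorem unit_place (T : Rect n) : (unit T.cube).place T = T := by
  ext <;> simp [place, unit]

theorem place_assoc (R S T : Rect n) : (R.place S).place T = R.place (S.place T) := by
  ext <;> simp [place] <;> ring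

theorem place_lowerHalf (R T : Rect n) (d : Fin n) :
    R.place (T.lowerHalf d) = (R.place T).lowerHalf d := by
  ext e
  · rfl
  · rfl
  · by_cases h : e = d
    · subst h; simp [place, lowerHalf]; ring
    · simp [place, lowerHalf, h]

theorem place_upperHalf (R T : Rect n) (d : Fin n) :
    R.place (T.upperHalf d) = (R.place T).upperHalf d := by
  ext e
  · rfl
  · by_cases h : e = d
    · subst h; simp [place, upperHalf]; ring
    · simp [place, upperHalf, h]
  · by_cases h : e = d
    · subst h; simp [place, upperHalf]; ring
    · simp [place, upperHalf, h]

theorem unit_injective : Function.Injective (unit : ℕ → Rect n) :=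
  fun _ _ h => congrArg cube h

/-- Membership of the point `x` of the cube `Sᵢ` in the interior of `R`. -/
def Inside (R : Rect n) (i : ℕ) (x : Fin n → ℝ) : Prop :=
  R.cube = i ∧ ∀ d, R.corner d < x d ∧ x d < R.corner d + R.side d

theorem Inside.of_lowerHalf {R : Rect n} {e : Fin n} (hR : ∀ d, 0 < R.side d) {i x}
    (h : (R.lowerHalf e).Inside i x) : R.Inside i x ∧ x e < R.corner e + R.side e / 2 := by
  have he := h.2 e
  simp only [lowerHalf, Function.update_self] at he
  refine ⟨⟨h.1, fun d => ?_⟩, he.2⟩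
  have hd := h.2 d
  by_cases hde : d = e
  · subst hde
    have := hR d
    constructor <;> linarith
  · simpa [lowerHalf, hde] using hd

theorem Inside.of_upperHalf {R : Rect n} {e : Fin n} (hR : ∀ d, 0 < R.side d) {i x}
    (h : (R.upperHalf e).Inside i x) : R.Inside i x ∧ R.corner e + R.side e / 2 < x e := by
  have he := h.2 e
  simp only [upperHalf, Function.update_self] at he
  refine ⟨⟨h.1, fun d => ?_⟩, he.1⟩
  have hd := h.2 d
  by_cases hde : d = e
  · subst hde
    have := hR d
    constructor <;> linarith
  · simpa [upperHalf, hde] using hd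

end Rect

/-- Patterns in `X`: the subdivisions of `X` into rectangles that arise from the undivided `X` by
finitely many cuts, each of which cuts one rectangle in half across one dimension. -/
inductive IsPattern : Set (Rect n) → Prop
  | undivided : IsPattern (Set.range Rect.unit)
  | cut (P : Set (Rect n)) (R : Rect n) (d : Fin n) : IsPattern P → R ∈ P →
      IsPattern ((P \ {R}) ∪ {R.lowerHalf d, R.upperHalf d})

theorem IsPattern.bounds {P : Set (Rect n)} (hP : IsPattern P) : ∀ R ∈ P, ∀ d,
    0 < R.side d ∧ 0 ≤ R.corner d ∧ R.corner d + R.side d ≤ 1 := by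
  induction hP with
  | undivided =>
    rintro _ ⟨i, rfl⟩ d
    simp [Rect.unit]
  | cut P R e _ hR ih =>
    rintro T (⟨hT, -⟩ | rfl | rfl) d
    · exact ih T hT d
    · have := ih R hR d
      by_cases h : d = e
      · subst h
        simp only [Rect.lowerHalf, Function.update_self]
        refine ⟨?_, ?_, ?_⟩ <;> linarith
      · simpa [Rect.lowerHalf, h] using this
    · have := ih R hR d
      by_cases h : d = e
      · subst h
        simp only [Rect.upperHalf, Function.update_self]
        refine ⟨?_, ?_, ?_⟩ <;> linarith
      · simpa [Rect.upperHalf, h] using this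

/-- Two rectangles of a pattern that share an interior point are equal. -/
theorem IsPattern.eq_of_inside {P : Set (Rect n)} (hP : IsPattern P) : ∀ R ∈ P, ∀ T ∈ P, ∀ i x,
    R.Inside i x → T.Inside i x → R = T := by
  induction hP with
  | undivided =>
    rintro _ ⟨j, rfl⟩ _ ⟨k, rfl⟩ i x h h'
    have h1 : j = i := h.1
    have h2 : k = i := h'.1
    rw [h1, h2]
  | cut P R e hP hR ih =>
    have hpos : ∀ d, 0 < R.side d := fun d => (hP.bounds R hR d).1
    rintro A (⟨hA, hAR⟩ | rfl | rfl) B (⟨hB, hBR⟩ | rfl | rfl) i x hx hy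
    · exact ih A hA B hB i x hx hy
    · exact absurd (ih A hA R hR i x hx (hy.of_lowerHalf hpos).1) hAR
    · exact absurd (ih A hA R hR i x hx (hy.of_upperHalf hpos).1) hAR
    · exact absurd (ih B hB R hR i x hy (hx.of_lowerHalf hpos).1) hBR
    · rfl
    · have h1 := (hx.of_lowerHalf hpos).2
      have h2 := (hy.of_upperHalf hpos).2
      linarith
    · exact absurd (ih B hB R hR i x hy (hx.of_upperHalf hpos).1) hBR
    · have h1 := (hx.of_upperHalf hpos).2
      have h2 := (hy.of_lowerHalf hpos).2
      linarith
    · rfl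

/-- A numbered pattern in `X`: a pattern together with a numbering of its rectangles by `0, 1, 2, …`
(`num j` is the rectangle with number `j`, every rectangle gets exactly one number) which, far out,
numbers the (undivided) unit cubes in order. -/
@[ext]
structure NumberedPattern (n : ℕ) where
  num : ℕ → Rect n
  injective : Function.Injective num
  isPattern : IsPattern (Set.range num)
  eventually_unit : ∃ N k : ℕ, ∀ j, N ≤ j → num (j + k) = Rect.unit j

namespace NumberedPattern

/-- Insert the pieces of the unit cubes `Sᵢ` into the rectangles numbered `i` of `P`. -/
def insert (P : NumberedPattern n) (T : Rect n) : Rect n := (P.num T.cube).place T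

theorem insert_injOn (P : NumberedPattern n) {B : Set (Rect n)} (hB : IsPattern B) :
    Set.InjOn P.insert B := by
  have key : ∀ T ∈ B, (P.num T.cube).Inside (P.insert T).cube
      (fun d => (P.insert T).corner d + (P.insert T).side d / 2) := by
    intro T hT
    refine ⟨rfl, fun d => ?_⟩
    have h1 := hB.bounds T hT d
    have h2 := (P.isPattern.bounds _ (Set.mem_range_self T.cube) d).1
    simp only [insert, Rect.place]
    constructor <;> nlinarith [mul_pos h2 h1.1, mul_nonneg h2.le h1.2.1]
  intro S hS T hT h
  have hST := P.isPattern.eq_of_inside _ (Set.mem_range_self S.cube) _ (Set.mem_range_self T.cube)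
    _ _ (key S hS) (by rw [h]; exact key T hT)
  have hc : S.cube = T.cube := P.injective hST
  have hne : ∀ d, (P.num T.cube).side d ≠ 0 := fun d =>
    (P.isPattern.bounds _ (Set.mem_range_self T.cube) d).1.ne'
  simp only [insert, hc, Rect.place, Rect.mk.injEq, true_and] at h
  refine Rect.ext hc (funext fun d => ?_) (funext fun d => ?_)
  · exact mul_left_cancel₀ (hne d) (add_left_cancel (congrFun h.1 d))
  · exact mul_left_cancel₀ (hne d) (congrFun h.2 d)

theorem isPattern_image (P : NumberedPattern n) {B : Set (Rect n)} (hB : IsPattern B) :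
    IsPattern (P.insert '' B) := by
  induction hB with
  | undivided =>
    have : P.insert '' Set.range Rect.unit = Set.range P.num := by
      rw [← Set.range_comp]
      congr 1
      funext i
      simp [insert]
    rw [this]
    exact P.isPattern
  | cut B R d hB hR ih =>
    have h1 : P.insert (R.lowerHalf d) = (P.insert R).lowerHalf d := Rect.place_lowerHalf _ _ _
    have h2 : P.insert (R.upperHalf d) = (P.insert R).upperHalf d := Rect.place_upperHalf _ _ _
    rw [Set.image_union, Set.image_pair, h1, h2,
      (P.insert_injOn hB).image_sdiff_subset (Set.singleton_subset_iff.2 hR), Set.image_singleton]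
    exact IsPattern.cut _ _ _ ih (Set.mem_image_of_mem _ hR)

/-- The trivial numbered pattern: nothing is cut and `Sᵢ` has number `i`. -/
instance : One (NumberedPattern n) :=
  ⟨⟨Rect.unit, Rect.unit_injective, .undivided, 0, 0, fun _ _ => rfl⟩⟩

/-- The product `P * Q` applies, for every `i`, the pattern that `Q` has in the unit cube `Sᵢ` to the
rectangle numbered `i` of `P`; the numbers of the new rectangles are those of `Q`. -/
instance : Mul (NumberedPattern n) :=
  ⟨fun P Q =>
    { num := fun j => (P.num (Q.num j).cube).place (Q.num j)
      injective := fun _ _ h => Q.injective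
        (P.insert_injOn Q.isPattern (Set.mem_range_self _) (Set.mem_range_self _) h)
      isPattern := by
        have := P.isPattern_image Q.isPattern
        rwa [← Set.range_comp] at this
      eventually_unit := by
        obtain ⟨N, k, hP⟩ := P.eventually_unit
        obtain ⟨M, l, hQ⟩ := Q.eventually_unit
        refine ⟨N + M, k + l, fun j hj => ?_⟩
        rw [← add_assoc, hQ (j + k) (by omega), Rect.unit_cube, hP j (by omega), Rect.place_unit] }⟩

@[simp] theorem one_num (j : ℕ) : (1 : NumberedPattern n).num j = Rect.unit j := rfl

@[simp] theorem mul_num (P Q : NumberedPattern n) (j : ℕ) :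
    (P * Q).num j = (P.num (Q.num j).cube).place (Q.num j) := rfl

/-- The monoid `Πₙ` of numbered patterns. -/
instance : Monoid (NumberedPattern n) where
  mul_assoc P Q R := by
    ext1
    funext j
    simp only [mul_num, Rect.place_assoc]
    rfl
  one_mul P := by
    ext1
    funext j
    simp
  mul_one P := by
    ext1
    funext j
    simp

/-- The numbering after `Sᵢ` is cut in half across dimension `d`: the first half keeps the number
`i`, the second half gets the number `i + 1`, and all numbers above `i` shift up by one. -/
def cutNum (i : ℕ) (d : Fin n) (j : ℕ) : Rect n :=
  if j < i then Rect.unit j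
  else if j = i then (Rect.unit i).lowerHalf d
  else if j = i + 1 then (Rect.unit i).upperHalf d
  else Rect.unit (j - 1)

theorem cutNum_injective (i : ℕ) (d : Fin n) : Function.Injective (cutNum i d) := by
  have hcube : ∀ j, (cutNum i d j).cube = if j ≤ i then j else j - 1 := by
    intro j
    unfold cutNum
    split_ifs <;> simp [Rect.lowerHalf, Rect.upperHalf] <;> omega
  have hne : cutNum i d i ≠ cutNum i d (i + 1) := by
    intro h
    have := congrFun (congrArg Rect.corner h) d
    simp [cutNum, Rect.lowerHalf, Rect.upperHalf, Rect.unit] at this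
  intro a b h
  have hc := congrArg Rect.cube h
  rw [hcube, hcube] at hc
  by_contra hab
  have : (a = i ∧ b = i + 1) ∨ (b = i ∧ a = i + 1) := by
    split_ifs at hc <;> omega
  rcases this with ⟨rfl, rfl⟩ | ⟨rfl, rfl⟩
  · exact hne h
  · exact hne h.symm

theorem range_cutNum (i : ℕ) (d : Fin n) : Set.range (cutNum i d) =
    (Set.range Rect.unit \ {Rect.unit i}) ∪
      {(Rect.unit i).lowerHalf d, (Rect.unit i).upperHalf d} := by
  ext R
  constructor
  · rintro ⟨j, rfl⟩
    unfold cutNum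
    split_ifs with h1 h2 h3
    · exact Or.inl ⟨⟨j, rfl⟩, fun h => h1.ne (Rect.unit_injective h)⟩
    · exact Or.inr (Or.inl rfl)
    · exact Or.inr (Or.inr rfl)
    · refine Or.inl ⟨⟨j - 1, rfl⟩, fun h => ?_⟩
      have := Rect.unit_injective h
      omega
  · rintro (⟨⟨j, rfl⟩, hj⟩ | rfl | rfl)
    · have hji : j ≠ i := fun h => hj (by rw [h]; rfl)
      rcases lt_or_gt_of_ne hji with h | h
      · exact ⟨j, by simp [cutNum, h]⟩
      · refine ⟨j + 1, ?_⟩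
        have h1 : ¬ j + 1 < i := by omega
        have h2 : ¬ j + 1 = i := by omega
        simp [cutNum, h1, h2, hji]
    · exact ⟨i, by simp [cutNum]⟩
    · exact ⟨i + 1, by simp [cutNum]⟩

/-- The element `s_{i,d}` of `Πₙ`, which cuts `Sᵢ` in half across dimension `d`. -/
def s (i : ℕ) (d : Fin n) : NumberedPattern n where
  num := cutNum i d
  injective := cutNum_injective i d
  isPattern := by
    rw [range_cutNum]
    exact .cut _ _ _ .undivided ⟨i, rfl⟩
  eventually_unit := by
    refine ⟨i + 1, 1, fun j hj => ?_⟩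
    have h1 : ¬ j + 1 < i := by omega
    have h2 : ¬ j + 1 = i := by omega
    have h3 : j ≠ i := by omega
    simp [cutNum, h1, h2, h3]

/-- The element `σᵢ` of `Πₙ`, which cuts nothing and exchanges the numbers `i` and `i + 1`. -/
def σ (i : ℕ) : NumberedPattern n where
  num j := Rect.unit (Equiv.swap i (i + 1) j)
  injective := Rect.unit_injective.comp (Equiv.swap i (i + 1)).injective
  isPattern := by
    have : (Set.range fun j => (Rect.unit (Equiv.swap i (i + 1) j) : Rect n)) =
        Set.range Rect.unit := (Equiv.swap i (i + 1)).surjective.range_comp Rect.unit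
    rw [this]
    exact .undivided
  eventually_unit := by
    refine ⟨i + 2, 0, fun j hj => ?_⟩
    rw [add_zero, Equiv.swap_apply_of_ne_of_ne (by omega) (by omega)]

end NumberedPattern

/-- The abstract generators `s_{i,d}` and `σᵢ`. -/
inductive Gen (n : ℕ)
  | s (i : ℕ) (d : Fin n)
  | σ (i : ℕ)

/-- The generators `s_{i,d}` as words. -/
def ws (i : ℕ) (d : Fin n) : FreeMonoid (Gen n) := FreeMonoid.of (Gen.s i d)

/-- The generators `σᵢ` as words. -/
def wσ (i : ℕ) : FreeMonoid (Gen n) := FreeMonoid.of (Gen.σ i)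

/-- The defining relations between words in the generators. -/
inductive Rel (n : ℕ) : FreeMonoid (Gen n) → FreeMonoid (Gen n) → Prop
  | M1 (i j : ℕ) (d d' : Fin n) : i < j → Rel n (ws j d' * ws i d) (ws i d * ws (j + 1) d')
  | M2 (i : ℕ) : Rel n (wσ i * wσ i) 1
  | M3 (i j : ℕ) : 2 ≤ |(i : ℤ) - (j : ℤ)| → Rel n (wσ i * wσ j) (wσ j * wσ i)
  | M4 (i : ℕ) : Rel n (wσ i * wσ (i + 1) * wσ i) (wσ (i + 1) * wσ i * wσ (i + 1))
  | M5a (i j : ℕ) (d : Fin n) : i < j → Rel n (wσ j * ws i d) (ws i d * wσ (j + 1))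
  | M5b (i j : ℕ) (d : Fin n) : i = j → Rel n (wσ j * ws i d) (ws (j + 1) d * wσ j * wσ (j + 1))
  | M5c (i j : ℕ) (d : Fin n) : i = j + 1 → Rel n (wσ j * ws i d) (ws j d * wσ (j + 1) * wσ j)
  | M5d (i j : ℕ) (d : Fin n) : j + 1 < i → Rel n (wσ j * ws i d) (ws i d * wσ j)
  | M6 (i : ℕ) (d d' : Fin n) : d ≠ d' →
      Rel n (ws i d * ws (i + 1) d' * ws i d') (ws i d' * ws (i + 1) d * ws i d * wσ (i + 1))

end CubePattern

end

namespace CubePattern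

variable {n : ℕ}

/-! ### Cuts across different dimensions commute. -/

namespace Rect

/-! The relations hold for numbered patterns, which gives the homomorphism `ofPresented`; it has to
be shown bijective.

Injectivity rests on reading left divisibility by a cut off the pattern: by
`exists_eq_s_mul_of_splits`, if no rectangle in the image of `x` crosses the midplane of `Sᵢ` across
`d`, then `x = s i d * y`. The decisive case is an `x` that begins with a cut of `Sᵢ` across another
dimension: both halves are then split across `d`, and M6 exchanges the order of the cuts. Now let
`x` and `y` have the same image. If one of them contains a cut, M5 moves a cut to its front
(`exists_eq_s_mul_of_cuts`), so the common image splits there, both elements are divisible by that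
cut, and `s_mul_cancel` allows induction on the number of cuts. If neither contains a cut, both are
words in the `σ j`, and M2–M4 are the Coxeter relations of the symmetric groups
(`eq_one_of_mem_braidSubmonoid`).

For surjectivity, right multiplication by `s i d` performs any desired cut, so every pattern occurs
with some numbering. Two numberings of one pattern differ by a permutation of finite support, which
is a product of adjacent transpositions. -/

theorem lowerHalf_lowerHalf_comm (R : Rect n) {d e : Fin n} (h : d ≠ e) :
    (R.lowerHalf d).lowerHalf e = (R.lowerHalf e).lowerHalf d := by
  simp only [lowerHalf, Function.update_of_ne h, Function.update_of_ne h.symm,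
    Function.update_comm h]

theorem upperHalf_upperHalf_comm (R : Rect n) {d e : Fin n} (h : d ≠ e) :
    (R.upperHalf d).upperHalf e = (R.upperHalf e).upperHalf d := by
  simp only [upperHalf, Function.update_of_ne h, Function.update_of_ne h.symm,
    Function.update_comm h]

theorem lowerHalf_upperHalf_comm (R : Rect n) {d e : Fin n} (h : d ≠ e) :
    (R.lowerHalf d).upperHalf e = (R.upperHalf e).lowerHalf d := by
  simp only [upperHalf, lowerHalf, Function.update_of_ne h, Function.update_of_ne h.symm,
    Function.update_comm h]

end Rect

/-! ### Right multiplication by generators, and the homomorphism. -/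

namespace NumberedPattern

theorem mul_s_num (P : NumberedPattern n) (i : ℕ) (d : Fin n) (j : ℕ) :
    (P * s i d).num j = if j < i then P.num j else if j = i then (P.num i).lowerHalf d
      else if j = i + 1 then (P.num i).upperHalf d else P.num (j - 1) := by
  change (P.num (cutNum i d j).cube).place (cutNum i d j) = _
  unfold cutNum
  split_ifs
  · simp
  · rw [Rect.place_lowerHalf]
    exact congrArg (Rect.lowerHalf · d) (Rect.place_unit _ _)
  · rw [Rect.place_upperHalf]
    exact congrArg (Rect.upperHalf · d) (Rect.place_unit _ _)
  · simp

theorem mul_σ_num (P : NumberedPattern n) (i j : ℕ) :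
    (P * σ i).num j = P.num (Equiv.swap i (i + 1) j) := by
  change (P.num (Rect.unit (Equiv.swap i (i + 1) j) : Rect n).cube).place
    (Rect.unit (Equiv.swap i (i + 1) j)) = _
  rw [Rect.place_unit, Rect.unit_cube]

/-- The numbered pattern of an abstract generator. -/
noncomputable def ofGen : Gen n → NumberedPattern n
  | .s i d => s i d
  | .σ i => σ i

theorem lift_ofGen_eq_of_rel (u v : FreeMonoid (Gen n)) (h : Rel n u v) :
    FreeMonoid.lift ofGen u = FreeMonoid.lift ofGen v := by
  -- The numbering formulas describe right multiplication by one generator, so both words are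
  -- applied, letter by letter, to an arbitrary `P`.
  rw [← one_mul (FreeMonoid.lift ofGen u), ← one_mul (FreeMonoid.lift ofGen v)]
  generalize (1 : NumberedPattern n) = P
  cases h <;> simp only [map_mul, map_one, ws, wσ, FreeMonoid.lift_eval_of, ofGen, ← mul_assoc] <;>
    ext1 <;> funext k <;> simp only [mul_s_num, mul_σ_num, mul_one, Equiv.swap_apply_def]
  case M6 i d d' h =>
    have h1 := (P.num i).lowerHalf_lowerHalf_comm h
    have h2 := (P.num i).upperHalf_upperHalf_comm h
    have h3 := (P.num i).lowerHalf_upperHalf_comm h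
    have h4 := (P.num i).lowerHalf_upperHalf_comm h.symm
    grind
  all_goals grind

/-- The homomorphism from the presented monoid to the monoid of numbered patterns. -/
noncomputable def ofPresented : PresentedMonoid (Rel n) →* NumberedPattern n :=
  PresentedMonoid.lift ofGen lift_ofGen_eq_of_rel

/-! ### Left cancellation, and splitting across a midplane. -/

theorem s_mul_cancel {i : ℕ} {d : Fin n} {P Q : NumberedPattern n} (h : s i d * P = s i d * Q) :
    P = Q := by
  ext1
  funext j
  have h := congrFun (congrArg num h) j
  -- The centre of a rectangle of the product is interior to the rectangle of `s i d` containing it,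
  -- and so determines the number of the latter.
  have key : ∀ T : NumberedPattern n, ((s i d).num (T.num j).cube).Inside
      ((s i d * T).num j).cube
      (fun d' => ((s i d * T).num j).corner d' + ((s i d * T).num j).side d' / 2) := by
    intro T
    refine ⟨rfl, fun e => ?_⟩
    have h1 := T.isPattern.bounds _ (Set.mem_range_self j) e
    have h2 := ((s i d).isPattern.bounds _ (Set.mem_range_self (T.num j).cube) e).1
    simp only [mul_num, Rect.place]
    constructor <;> nlinarith [mul_pos h2 h1.1, mul_nonneg h2.le h1.2.1]
  have hc : (P.num j).cube = (Q.num j).cube :=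
    (s i d).injective ((s i d).isPattern.eq_of_inside _ (Set.mem_range_self _) _
      (Set.mem_range_self _) _ _ (key P) (by rw [h]; exact key Q))
  have hne : ∀ e, ((s i d).num (Q.num j).cube).side e ≠ 0 := fun e =>
    ((s i d).isPattern.bounds _ (Set.mem_range_self _) e).1.ne'
  simp only [mul_num, hc, Rect.place, Rect.mk.injEq, true_and] at h
  refine Rect.ext hc (funext fun e => ?_) (funext fun e => ?_)
  · exact mul_left_cancel₀ (hne e) (add_left_cancel (congrFun h.1 e))
  · exact mul_left_cancel₀ (hne e) (congrFun h.2 e)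

/-- Every rectangle of `P` in the cube `Sᵢ` lies on one side of the midplane across dimension `d`. -/
def Splits (P : NumberedPattern n) (i : ℕ) (d : Fin n) : Prop :=
  ∀ l, (P.num l).cube = i →
    (P.num l).corner d + (P.num l).side d ≤ 1 / 2 ∨ 1 / 2 ≤ (P.num l).corner d

/-- Since rectangle `c` of `P` spans the full width of `Sᵢ` in dimension `d`, placing the pieces of
`S_c` into it leaves their `d`-coordinates unchanged. -/
theorem Splits.of_mul {P Q : NumberedPattern n} {i c : ℕ} {d : Fin n} (h : (P * Q).Splits i d)
    (hi : (P.num c).cube = i) (h0 : (P.num c).corner d = 0) (h1 : (P.num c).side d = 1) :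
    Q.Splits c d := by
  rintro l rfl
  have := h l hi
  simpa only [mul_num, Rect.place, h0, h1, zero_add, one_mul] using this

theorem not_splits_one (i : ℕ) (d : Fin n) : ¬ (1 : NumberedPattern n).Splits i d := by
  intro h
  have := h i rfl
  norm_num [Rect.unit] at this

theorem splits_s_mul (i : ℕ) (d : Fin n) (Q : NumberedPattern n) : (s i d * Q).Splits i d := by
  intro l hl
  have hb := Q.isPattern.bounds _ (Set.mem_range_self l) d
  change (cutNum i d (Q.num l).cube).cube = i at hl
  change (cutNum i d (Q.num l).cube).corner d + (cutNum i d (Q.num l).cube).side d * _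
    + (cutNum i d (Q.num l).cube).side d * _ ≤ _ ∨
    _ ≤ (cutNum i d (Q.num l).cube).corner d + (cutNum i d (Q.num l).cube).side d * _
  unfold cutNum at hl ⊢
  split_ifs at hl ⊢
  · simp at hl; omega
  · left; simp [Rect.lowerHalf, Rect.unit]; linarith
  · right; simp [Rect.upperHalf, Rect.unit]; linarith
  · simp at hl; omega

theorem Splits.of_σ_mul {Q : NumberedPattern n} {i j : ℕ} {d : Fin n} (h : (σ j * Q).Splits i d) :
    Q.Splits (Equiv.swap j (j + 1) i) d :=
  h.of_mul (by simp [σ]) rfl rfl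

theorem Splits.of_s_mul_of_lt {Q : NumberedPattern n} {i j : ℕ} {d e : Fin n} (hij : i < j)
    (h : (s j e * Q).Splits i d) : Q.Splits i d :=
  have hu : (s j e).num i = Rect.unit i := if_pos hij
  h.of_mul (by rw [hu]; rfl) (by rw [hu]; rfl) (by rw [hu]; rfl)

theorem Splits.of_s_mul_of_gt {Q : NumberedPattern n} {i j : ℕ} {d e : Fin n} (hij : j < i)
    (h : (s j e * Q).Splits i d) : Q.Splits (i + 1) d :=
  have hu : (s j e).num (i + 1) = Rect.unit i := by
    change cutNum _ _ _ = _
    unfold cutNum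
    rw [if_neg (by omega), if_neg (by omega), if_neg (by omega), Nat.add_sub_cancel]
  h.of_mul (by rw [hu]; rfl) (by rw [hu]; rfl) (by rw [hu]; rfl)

theorem Splits.of_s_mul_lower {Q : NumberedPattern n} {i : ℕ} {d e : Fin n} (hde : d ≠ e)
    (h : (s i e * Q).Splits i d) : Q.Splits i d :=
  have hu : (s i e).num i = (Rect.unit i).lowerHalf e := by
    change cutNum _ _ _ = _
    simp [cutNum]
  h.of_mul (by rw [hu]; rfl) (by rw [hu]; rfl) (by rw [hu]; simp [Rect.lowerHalf, hde, Rect.unit])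

theorem Splits.of_s_mul_upper {Q : NumberedPattern n} {i : ℕ} {d e : Fin n} (hde : d ≠ e)
    (h : (s i e * Q).Splits i d) : Q.Splits (i + 1) d :=
  have hu : (s i e).num (i + 1) = (Rect.unit i).upperHalf e := by
    change cutNum _ _ _ = _
    simp [cutNum]
  h.of_mul (by rw [hu]; rfl) (by rw [hu]; simp [Rect.upperHalf, hde, Rect.unit])
    (by rw [hu]; simp [Rect.upperHalf, hde, Rect.unit])

end NumberedPattern

/-! ### Moving generators past each other in the presented monoid. -/

namespace Presented

open NumberedPattern

/-- The generator `s_{i,d}` of the presented monoid. -/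
def s (i : ℕ) (d : Fin n) : PresentedMonoid (Rel n) := PresentedMonoid.of _ (.s i d)

/-- The generator `σᵢ` of the presented monoid. -/
def σ (i : ℕ) : PresentedMonoid (Rel n) := PresentedMonoid.of _ (.σ i)

@[simp] theorem ofPresented_s (i : ℕ) (d : Fin n) :
    ofPresented (s i d) = NumberedPattern.s i d := rfl

@[simp] theorem ofPresented_σ (i : ℕ) :
    ofPresented (σ i : PresentedMonoid (Rel n)) = NumberedPattern.σ i := rfl

theorem s_mul_s {i j : ℕ} (h : i < j) (d d' : Fin n) : s j d' * s i d = s i d * s (j + 1) d' :=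
  PresentedMonoid.mk_eq_mk_of_rel (.M1 i j d d' h)

theorem σ_mul_σ_self (i : ℕ) : (σ i * σ i : PresentedMonoid (Rel n)) = 1 :=
  PresentedMonoid.mk_eq_mk_of_rel (.M2 i)

theorem σ_mul_σ_comm {i j : ℕ} (h : i + 2 ≤ j) :
    (σ i * σ j : PresentedMonoid (Rel n)) = σ j * σ i :=
  PresentedMonoid.mk_eq_mk_of_rel (.M3 i j (by rw [abs_sub_comm, abs_of_nonneg] <;> omega))

theorem braid (i : ℕ) :
    (σ i * σ (i + 1) * σ i : PresentedMonoid (Rel n)) = σ (i + 1) * σ i * σ (i + 1) :=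
  PresentedMonoid.mk_eq_mk_of_rel (.M4 i)

theorem s_mul_s_mul_s (i : ℕ) {d d' : Fin n} (h : d ≠ d') :
    s i d * s (i + 1) d' * s i d' = s i d' * s (i + 1) d * s i d * σ (i + 1) :=
  PresentedMonoid.mk_eq_mk_of_rel (.M6 i d d' h)

/-- The four cases of M5 in one form; what remains behind the cut is irrelevant for divisibility. -/
theorem exists_σ_mul_s (j i : ℕ) (d : Fin n) :
    ∃ t, σ j * s (Equiv.swap j (j + 1) i) d = s i d * t := by
  rcases lt_trichotomy i j with h | rfl | h
  · rw [Equiv.swap_apply_of_ne_of_ne (by omega) (by omega)]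
    exact ⟨σ (j + 1), PresentedMonoid.mk_eq_mk_of_rel (.M5a i j d h)⟩
  · rw [Equiv.swap_apply_left]
    exact ⟨σ (i + 1) * σ i, PresentedMonoid.mk_eq_mk_of_rel (.M5c (i + 1) i d rfl)⟩
  · rcases Nat.eq_or_lt_of_le h with rfl | h
    · rw [Nat.succ_eq_add_one, Equiv.swap_apply_right]
      exact ⟨σ j * σ (j + 1), PresentedMonoid.mk_eq_mk_of_rel (.M5b j j d rfl)⟩
    · rw [Equiv.swap_apply_of_ne_of_ne (by omega) (by omega)]
      exact ⟨σ j, PresentedMonoid.mk_eq_mk_of_rel (.M5d i j d h)⟩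

/-- The number of cuts of an element of the presented monoid. -/
def cuts : PresentedMonoid (Rel n) →* Multiplicative ℕ :=
  PresentedMonoid.lift
    (fun | .s _ _ => Multiplicative.ofAdd 1 | .σ _ => 1) (by
      intro u v h
      cases h <;> simp [ws, wσ])

@[simp] theorem cuts_s (i : ℕ) (d : Fin n) : cuts (s i d) = Multiplicative.ofAdd 1 := rfl

@[simp] theorem cuts_σ (i : ℕ) : cuts (σ i : PresentedMonoid (Rel n)) = 1 := rfl

theorem cuts_s_mul (i : ℕ) (d : Fin n) (x : PresentedMonoid (Rel n)) :
    (cuts (s i d * x)).toAdd = (cuts x).toAdd + 1 := by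
  simp [add_comm]

theorem induction_mul {p : PresentedMonoid (Rel n) → Prop} (one : p 1)
    (s_mul : ∀ i d x, p x → p (s i d * x)) (σ_mul : ∀ i x, p x → p (σ i * x)) (x) : p x := by
  obtain ⟨w, rfl⟩ := PresentedMonoid.surjective_mk x
  induction w using FreeMonoid.inductionOn' with
  | one => exact one
  | of_mul g w ih =>
    cases g with
    | s i d => exact s_mul i d _ ih
    | σ i => exact σ_mul i _ ih

/-! ### Divisibility by a cut. -/

theorem exists_eq_s_mul_of_splits (x : PresentedMonoid (Rel n)) (i : ℕ) (d : Fin n)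
    (h : (ofPresented x).Splits i d) : ∃ y, x = s i d * y := by
  induction hk : (cuts x).toAdd using Nat.strong_induction_on generalizing x i d with
  | _ k outer =>
  -- Removing a leading `σ j` keeps the number of cuts, hence the inner induction on words; a
  -- quotient by a cut need not be a subword, hence the outer induction.
  induction x using induction_mul generalizing i d with
  | one => exact absurd h (not_splits_one i d)
  | σ_mul j x ih =>
    rw [map_mul, ofPresented_σ] at h
    obtain ⟨y, rfl⟩ := ih _ _ h.of_σ_mul (by simpa using hk)
    obtain ⟨t, ht⟩ := exists_σ_mul_s j i d
    exact ⟨t * y, by rw [← mul_assoc, ht, mul_assoc]⟩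
  | s_mul j e x _ =>
    rw [cuts_s_mul] at hk
    rw [map_mul, ofPresented_s] at h
    rcases lt_trichotomy i j with hij | rfl | hij
    · obtain ⟨y, rfl⟩ := outer _ (by omega) x i d (h.of_s_mul_of_lt hij) rfl
      exact ⟨s (j + 1) e * y, by rw [← mul_assoc, s_mul_s hij, mul_assoc]⟩
    · by_cases hde : d = e
      · exact ⟨x, by rw [hde]⟩
      -- Both halves of `Sᵢ` are split across `d`. The upper factor is extracted first, as this
      -- leaves the index `i` of the lower half unchanged.
      · have h0 := h.of_s_mul_lower hde
        obtain ⟨y, rfl⟩ := outer _ (by omega) x (i + 1) d (h.of_s_mul_upper hde) rfl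
        rw [map_mul, ofPresented_s] at h0
        rw [cuts_s_mul] at hk
        obtain ⟨z, rfl⟩ := outer _ (by omega) y i d (h0.of_s_mul_of_lt i.lt_succ_self) rfl
        refine ⟨s (i + 1) e * s i e * σ (i + 1) * z, ?_⟩
        simp only [← mul_assoc]
        rw [s_mul_s_mul_s i (Ne.symm hde)]
    · obtain ⟨y, rfl⟩ := outer _ (by omega) x (i + 1) d (h.of_s_mul_of_gt hij) rfl
      exact ⟨s j e * y, by rw [← mul_assoc, ← s_mul_s hij, mul_assoc]⟩

theorem exists_eq_s_mul_of_cuts (x : PresentedMonoid (Rel n)) (h : cuts x ≠ 1) :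
    ∃ i d y, x = s i d * y := by
  induction x using induction_mul with
  | one => exact absurd (map_one _) h
  | s_mul i d x _ => exact ⟨i, d, x, rfl⟩
  | σ_mul j x ih =>
    obtain ⟨i, d, y, rfl⟩ := ih (by simpa using h)
    obtain ⟨t, ht⟩ := exists_σ_mul_s j (Equiv.swap j (j + 1) i) d
    rw [Equiv.swap_apply_self] at ht
    exact ⟨_, d, t * y, by rw [← mul_assoc, ht, mul_assoc]⟩

/-! ### Elements without cuts: the Coxeter presentation of the symmetric groups. -/

/-- The submonoid generated by the `σⱼ` with `m ≤ j < N`. -/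
def braidSubmonoid (n m N : ℕ) : Submonoid (PresentedMonoid (Rel n)) :=
  Submonoid.closure (σ '' Set.Ico m N)

theorem σ_mem_braidSubmonoid {m N j : ℕ} (h : m ≤ j) (h' : j < N) : σ j ∈ braidSubmonoid n m N :=
  Submonoid.subset_closure ⟨j, ⟨h, h'⟩, rfl⟩

theorem exists_mem_braidSubmonoid (x : PresentedMonoid (Rel n)) (h : cuts x = 1) :
    ∃ N, x ∈ braidSubmonoid n 0 N := by
  induction x using induction_mul with
  | one => exact ⟨0, one_mem _⟩
  | s_mul i d x _ =>
    have := cuts_s_mul i d x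
    simp [h] at this
  | σ_mul j x ih =>
    obtain ⟨N, hN⟩ := ih (by simpa using h)
    refine ⟨max N (j + 1), mul_mem (σ_mem_braidSubmonoid j.zero_le (by omega)) ?_⟩
    exact Submonoid.closure_mono
      (Set.image_mono (Set.Ico_subset_Ico_right (le_max_left _ _))) hN

/-- The product `σ_{m+r-1} ⋯ σ_{m+1} σ_m`. -/
def descending (m : ℕ) : ℕ → PresentedMonoid (Rel n)
  | 0 => 1
  | r + 1 => σ (m + r) * descending m r

theorem σ_mul_descending_of_gt {m r j : ℕ} (h : m + r < j) :
    (σ j * descending m r : PresentedMonoid (Rel n)) = descending m r * σ j := by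
  induction r with
  | zero => simp [descending]
  | succ r ih =>
    rw [descending, ← mul_assoc, ← σ_mul_σ_comm (by omega), mul_assoc, ih (by omega), mul_assoc]

theorem σ_mul_descending_of_lt {m r j : ℕ} (hm : m ≤ j) (h : j + 1 < m + r) :
    (σ j * descending m r : PresentedMonoid (Rel n)) = descending m r * σ (j + 1) := by
  induction r with
  | zero => omega
  | succ r ih =>
    by_cases hj : j + 1 < m + r
    · rw [descending, ← mul_assoc, σ_mul_σ_comm (by omega), mul_assoc, ih hj, mul_assoc]
    -- Here `σ j` meets the two leading factors `σ (j + 1) * σ j`, and the braid relation applies.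
    · obtain ⟨r, rfl⟩ : ∃ q, r = q + 1 := ⟨r - 1, by omega⟩
      obtain rfl : j = m + r := by omega
      rw [descending, descending, ← mul_assoc, ← mul_assoc, ← add_assoc, braid, mul_assoc _ (σ _),
        σ_mul_descending_of_gt (by omega)]
      simp only [mul_assoc]

/-- The `descending m r` represent the cosets of the stabilizer of `m`: a new factor `σ j` on the
left passes through, cancels the leading factor, or lengthens the product. -/
theorem exists_eq_descending_mul {m N : ℕ} (hmN : m ≤ N) {x : PresentedMonoid (Rel n)}
    (hx : x ∈ braidSubmonoid n m N) :
    ∃ r, m + r ≤ N ∧ ∃ y ∈ braidSubmonoid n (m + 1) N, x = descending m r * y := by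
  induction hx using Submonoid.closure_induction_left with
  | one => exact ⟨0, hmN, 1, one_mem _, (mul_one _).symm⟩
  | mul_left a ha x _ ih =>
    obtain ⟨j, ⟨hj, hjN⟩, rfl⟩ := ha
    obtain ⟨r, hr, y, hy, rfl⟩ := ih
    rcases lt_trichotomy j (m + r) with h | rfl | h
    · by_cases h' : j + 1 < m + r
      · exact ⟨r, hr, σ (j + 1) * y, mul_mem (σ_mem_braidSubmonoid (by omega) (by omega)) hy, by
          rw [← mul_assoc, σ_mul_descending_of_lt hj h', mul_assoc]⟩
      · obtain ⟨r, rfl⟩ : ∃ q, r = q + 1 := ⟨r - 1, by omega⟩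
        obtain rfl : j = m + r := by omega
        exact ⟨r, by omega, y, hy, by
          rw [descending, ← mul_assoc, ← mul_assoc, σ_mul_σ_self, one_mul]⟩
    · exact ⟨r + 1, hjN, y, hy, by rw [descending, mul_assoc]⟩
    · exact ⟨r, hr, σ j * y, mul_mem (σ_mem_braidSubmonoid (by omega) hjN) hy, by
        rw [← mul_assoc, σ_mul_descending_of_gt h, mul_assoc]⟩

theorem ofPresented_num_of_mem_braidSubmonoid {m N : ℕ} {x : PresentedMonoid (Rel n)}
    (hx : x ∈ braidSubmonoid n (m + 1) N) : (ofPresented x).num m = Rect.unit m := by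
  induction hx using Submonoid.closure_induction_left with
  | one => rfl
  | mul_left a ha x _ ih =>
    obtain ⟨j, ⟨hj, -⟩, rfl⟩ := ha
    have hfix : Equiv.swap j (j + 1) m = m := Equiv.swap_apply_of_ne_of_ne (by omega) (by omega)
    rw [map_mul, mul_num, ih, Rect.place_unit, ofPresented_σ]
    exact congrArg Rect.unit hfix

theorem ofPresented_descending_num (m r : ℕ) :
    (ofPresented (descending m r : PresentedMonoid (Rel n))).num m = Rect.unit (m + r) := by
  induction r with
  | zero => rfl
  | succ r ih =>
    rw [descending, map_mul, mul_num, ih, Rect.place_unit, ofPresented_σ]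
    exact congrArg Rect.unit (Equiv.swap_apply_left _ _)

/-- In `descending m r * y` the number `m` lies on the cube `m + r`, so a trivial image forces `r =
0`, and `y` involves one generator fewer. -/
theorem eq_one_of_mem_braidSubmonoid {m N : ℕ} {x : PresentedMonoid (Rel n)}
    (hx : x ∈ braidSubmonoid n m N) (h : ofPresented x = 1) : x = 1 := by
  induction hk : N - m generalizing m x with
  | zero =>
    rw [braidSubmonoid, Set.Ico_eq_empty (by omega), Set.image_empty, Submonoid.closure_empty] at hx
    exact hx
  | succ k ih =>
    obtain ⟨r, -, y, hy, rfl⟩ := exists_eq_descending_mul (by omega) hx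
    have hr := congrArg (fun P => (num P m).cube) h
    simp only [map_mul, mul_num, ofPresented_num_of_mem_braidSubmonoid hy, Rect.unit_cube,
      ofPresented_descending_num, Rect.place_unit, one_num] at hr
    obtain rfl : r = 0 := by omega
    rw [descending, one_mul] at h ⊢
    exact ih hy h (by omega)

theorem isUnit_of_mem_braidSubmonoid {m N : ℕ} {x : PresentedMonoid (Rel n)}
    (hx : x ∈ braidSubmonoid n m N) : IsUnit x := by
  refine (Submonoid.closure_le (S := IsUnit.submonoid _)).2 ?_ hx
  rintro _ ⟨j, -, rfl⟩
  exact ⟨⟨σ j, σ j, σ_mul_σ_self j, σ_mul_σ_self j⟩, rfl⟩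

theorem eq_of_ofPresented_eq_of_cuts {x y : PresentedMonoid (Rel n)} (hx : cuts x = 1)
    (hy : cuts y = 1) (h : ofPresented x = ofPresented y) : x = y := by
  obtain ⟨N, hN⟩ := exists_mem_braidSubmonoid x hx
  obtain ⟨u, rfl⟩ := isUnit_of_mem_braidSubmonoid hN
  have hu : cuts (↑u⁻¹ : PresentedMonoid (Rel n)) = 1 := by
    have := congrArg cuts u.inv_mul
    rwa [map_mul, hx, mul_one, map_one] at this
  obtain ⟨M, hM⟩ := exists_mem_braidSubmonoid ((↑u⁻¹ : PresentedMonoid (Rel n)) * y)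
    (by rw [map_mul, hu, hy, mul_one])
  have := eq_one_of_mem_braidSubmonoid hM (by rw [map_mul, ← h, ← map_mul, u.inv_mul, map_one])
  exact Units.inv_mul_eq_one.1 this

/-! ### Injectivity. -/

theorem ofPresented_injective : Function.Injective (ofPresented (n := n)) := by
  intro x y h
  induction hk : (cuts x).toAdd using Nat.strong_induction_on generalizing x y with
  | _ k ih =>
  by_cases hxy : cuts x = 1 ∧ cuts y = 1
  · exact eq_of_ofPresented_eq_of_cuts hxy.1 hxy.2 h
  -- A cut in either element suffices: splitting is a property of the common image.
  · obtain ⟨i, d, hs⟩ : ∃ i d, (ofPresented x).Splits i d := by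
      by_cases hx : cuts x = 1
      · obtain ⟨i, d, z, rfl⟩ := exists_eq_s_mul_of_cuts y fun hy => hxy ⟨hx, hy⟩
        exact ⟨i, d, by rw [h, map_mul]; exact splits_s_mul i d _⟩
      · obtain ⟨i, d, z, rfl⟩ := exists_eq_s_mul_of_cuts x hx
        exact ⟨i, d, by rw [map_mul]; exact splits_s_mul i d _⟩
    obtain ⟨y, rfl⟩ := exists_eq_s_mul_of_splits y i d (h ▸ hs)
    obtain ⟨x, rfl⟩ := exists_eq_s_mul_of_splits x i d hs
    rw [cuts_s_mul] at hk
    rw [map_mul, map_mul] at h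
    rw [ih _ (by omega) (s_mul_cancel h) rfl]

/-! ### Surjectivity. -/

theorem exists_range_ofPresented_num {S : Set (Rect n)} (hS : IsPattern S) :
    ∃ x, Set.range (ofPresented x).num = S := by
  induction hS with
  | undivided => exact ⟨1, rfl⟩
  | cut S R d _ hR ih =>
    obtain ⟨x, rfl⟩ := ih
    obtain ⟨i, rfl⟩ := hR
    refine ⟨x * s i d, ?_⟩
    have hsplit : (ofPresented (x * s i d)).num =
        (ofPresented x).insert ∘ (NumberedPattern.s i d).num := by
      rw [map_mul]; rfl
    have hunit : ∀ j, (ofPresented x).insert (Rect.unit j) = (ofPresented x).num j := by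
      simp [NumberedPattern.insert]
    have hlower : (ofPresented x).insert ((Rect.unit i).lowerHalf d) =
        ((ofPresented x).num i).lowerHalf d := by
      rw [← hunit]; exact Rect.place_lowerHalf _ _ _
    have hupper : (ofPresented x).insert ((Rect.unit i).upperHalf d) =
        ((ofPresented x).num i).upperHalf d := by
      rw [← hunit]; exact Rect.place_upperHalf _ _ _
    have hrange : (ofPresented x).insert '' Set.range Rect.unit =
        Set.range (ofPresented x).num := by
      rw [← Set.range_comp]
      exact congrArg Set.range (funext hunit)
    rw [hsplit, Set.range_comp]
    change _ '' Set.range (cutNum i d) = _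
    rw [range_cutNum, Set.image_union, Set.image_pair, hlower, hupper,
      ((ofPresented x).insert_injOn .undivided).image_sdiff_subset (by simp), Set.image_singleton,
      hunit, hrange]

theorem exists_mul_ofPresented_num (a : ℕ) (τ : Equiv.Perm ℕ) (hτ : ∀ j, a ≤ j → τ j = j) :
    ∃ x : PresentedMonoid (Rel n), ∀ (P : NumberedPattern n) (j : ℕ),
      (P * ofPresented x).num j = P.num (τ j) := by
  induction a generalizing τ with
  | zero =>
    exact ⟨1, fun P j => by rw [map_one, mul_one, hτ j j.zero_le]⟩
  | succ a outer =>
    have hle : ∀ τ : Equiv.Perm ℕ, (∀ j, a + 1 ≤ j → τ j = j) → τ a ≤ a := by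
      intro τ hτ
      by_contra h
      have := τ.injective (hτ (τ a) (by omega))
      omega
    induction hk : a - τ a generalizing τ with
    | zero =>
      refine outer τ fun j hj => ?_
      rcases hj.eq_or_lt with rfl | hj
      · have := hle τ hτ
        omega
      · exact hτ j hj
    | succ k ih =>
      -- The transposition raises the image of `a` by one, until `a` is fixed and the support bound
      -- drops.
      obtain ⟨x, hx⟩ := ih (Equiv.swap (τ a) (τ a + 1) * τ)
        (fun j hj => by
          rw [Equiv.Perm.mul_apply, hτ j hj, Equiv.swap_apply_of_ne_of_ne (by omega) (by omega)])
        (by rw [Equiv.Perm.mul_apply, Equiv.swap_apply_left]; omega)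
      refine ⟨σ (τ a) * x, fun P j => ?_⟩
      rw [map_mul, ← mul_assoc, hx, ofPresented_σ, mul_σ_num, Equiv.Perm.mul_apply,
        Equiv.swap_apply_self]

/-- The complements of the two tails are the finite sets `range a` and `range b`, which `τ` matches
bijectively. -/
theorem eq_of_perm_add {τ : Equiv.Perm ℕ} {a b : ℕ} (h : ∀ j, τ (j + a) = j + b) : a = b := by
  have : (Finset.range a).map τ.toEmbedding = Finset.range b := by
    ext l
    simp only [Finset.mem_map_equiv, Finset.mem_range]
    constructor
    · intro hl
      by_contra hb
      have h1 := h (l - b)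
      rw [Nat.sub_add_cancel (by omega)] at h1
      rw [← h1, Equiv.symm_apply_apply] at hl
      omega
    · intro hl
      by_contra ha
      have h1 := h (τ.symm l - a)
      rw [Nat.sub_add_cancel (by omega), Equiv.apply_symm_apply] at h1
      omega
  simpa using congrArg Finset.card this

theorem ofPresented_surjective : Function.Surjective (ofPresented (n := n)) := by
  intro P
  obtain ⟨x, hx⟩ := exists_range_ofPresented_num P.isPattern
  let Q := ofPresented x
  let τ : Equiv.Perm ℕ := (Equiv.ofInjective _ P.injective).trans
    ((Equiv.setCongr hx.symm).trans (Equiv.ofInjective _ Q.injective).symm)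
  have hτ : ∀ j, Q.num (τ j) = P.num j := fun j =>
    Equiv.apply_ofInjective_symm Q.injective
      (Equiv.setCongr hx.symm (Equiv.ofInjective _ P.injective j))
  obtain ⟨N, k, hP⟩ := P.eventually_unit
  obtain ⟨M, l, hQ⟩ := Q.eventually_unit
  -- Beyond both thresholds each numbering lists the undivided cubes in order, so `τ` is a shift
  -- there; the shift is then zero by `eq_of_perm_add`.
  have hshift : ∀ j, τ (j + (N + M + k)) = j + (N + M + l) := by
    intro j
    apply Q.injective
    rw [hτ, show j + (N + M + k) = j + N + M + k by omega, hP _ (by omega),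
      show j + (N + M + l) = j + N + M + l by omega, hQ _ (by omega)]
  have hkl := eq_of_perm_add hshift
  obtain ⟨y, hy⟩ := exists_mul_ofPresented_num (n := n) (N + M + k) τ fun j hj => by
    have := hshift (j - (N + M + k))
    rwa [← hkl, Nat.sub_add_cancel hj] at this
  refine ⟨x * y, ?_⟩
  ext1
  funext j
  rw [map_mul, hy, hτ]

end Presented

end CubePattern

theorem mainTheorem3 (n : ℕ) :
    ∃ φ : PresentedMonoid (CubePattern.Rel n) ≃* CubePattern.NumberedPattern n,
      (∀ (i : ℕ) (d : Fin n),
        φ (PresentedMonoid.of (CubePattern.Rel n) (CubePattern.Gen.s i d)) =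
          CubePattern.NumberedPattern.s i d) ∧
      (∀ i : ℕ,
        φ (PresentedMonoid.of (CubePattern.Rel n) (CubePattern.Gen.σ i)) =
          CubePattern.NumberedPattern.σ i) :=
  ⟨MulEquiv.ofBijective CubePattern.NumberedPattern.ofPresented
    ⟨CubePattern.Presented.ofPresented_injective, CubePattern.Presented.ofPresented_surjective⟩,
    fun _ _ => rfl, fun _ => rfl⟩
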